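/- For an integer $k\ge 1$ let $F_k:\mathbb N\to\mathbb N$ be defined by $F_k(0)=0$ and $F_k(n)=n-F_k^{k}(n-1)$ for $n\ge 1$, where $F_k^{k}$ denotes the $k$-th iterate of $F_k$. Let $\alpha_k$ be the unique positive real zero of $X^k+X-1$, put $\delta_k(n)=F_k(n)-\alpha_k n$ for $n\in\mathbb N$, and let $\Delta_k=\sup_{n\in\mathbb N}|\delta_k(n)|\in[0,+\infty]$. Put $$d_3^+=0.854187179928304211983581540152668,\qquad d_3^-=-0.708415898743967960305146324178773,$$ $$d_4^+=1.5834687793247475,\qquad d_4^-=-1.5060895457389591.$$ Then $$d_3^+-3\cdot10^{-33}\le\sup_{n\in\mathbb N}\delta_3(n)\le d_3^+,\qquad d_3^-\le\inf_{n\in\mathbb N}\delta_3(n)\le d_3^-+3\cdot10^{-33},$$ $$d_4^+-6\cdot10^{-16}\le\sup_{n\in\mathbb N}\delta_4(n)\le d_4^+,\qquad d_4^-\le\inf_{n\in\mathbb N}\delta_4(n)\le d_4^-+6\cdot10^{-16}.$$ Consequently $\Delta_3=\sup_n\delta_3(n)$ and $\Delta_4=\sup_n\delta_4(n)$, so that $$d_3^+-3\cdot10^{-33}\le\Delta_3\le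 d_3^+<1,\qquad d_4^+-6\cdot10^{-16}\le\Delta_4\le d_4^+<2.$$ -/

import Mathlib

namespace Hofstadter

/-- Auxiliary recursion for `F`: it returns `F k n` together with the bound `F k n ≤ n`,
which is what makes the nested recursive calls legitimate. -/
def FAux (k : ℕ) : (n : ℕ) → {m : ℕ // m ≤ n}
  | 0 => ⟨0, le_rfl⟩
  | n + 1 =>
    ⟨n + 1 - ((fun x : {m : ℕ // m ≤ n} =>
        (⟨(FAux k x.1).1, (FAux k x.1).2.trans x.2⟩ : {m : ℕ // m ≤ n}))^[k] ⟨n, le_rfl⟩).1,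
      Nat.sub_le _ _⟩
  termination_by n => n
  decreasing_by all_goals exact Nat.lt_succ_of_le x.2

/-- Hofstadter's function `F_k`, given by `F_k(0) = 0` and `F_k(n) = n - F_k^k(n-1)` for `n > 0`,
where `F_k^k` is the `k`-th iterate (see `F_zero` and `F_succ`). -/
def F (k n : ℕ) : ℕ := (FAux k n).1

theorem F_le (k n : ℕ) : F k n ≤ n := (FAux k n).2

theorem F_zero (k : ℕ) : F k 0 = 0 := by
  simp [F, FAux]

theorem F_iterate_le (k j n : ℕ) : (F k)^[j] n ≤ n := by
  induction j generalizing n with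
  | zero => exact le_rfl
  | succ j ih => exact (ih (F k n)).trans (F_le k n)

/-- The defining recursion of `F`. By `F_iterate_le` the subtraction is not truncated. -/
theorem F_succ (k n : ℕ) : F k (n + 1) = n + 1 - (F k)^[k] n := by
  have key : ∀ (j : ℕ) (y : {m : ℕ // m ≤ n}),
      ((fun x : {m : ℕ // m ≤ n} =>
        (⟨(FAux k x.1).1, (FAux k x.1).2.trans x.2⟩ : {m : ℕ // m ≤ n}))^[j] y).1
        = (F k)^[j] y.1 := by
    intro j
    induction j with
    | zero => intro y; rfl
    | succ j ih => intro y; rw [Function.iterate_succ_apply, Function.iterate_succ_apply, ih]; rfl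
  unfold F
  rw [FAux]
  exact congrArg (fun t => n + 1 - t) (key k ⟨n, le_rfl⟩)

/-- The polynomial `X ^ k + X - 1` has exactly one positive real zero (`k ≥ 1`). -/
theorem existsUnique_pos_zero {k : ℕ} (hk : 1 ≤ k) :
    ∃! x : ℝ, 0 < x ∧ x ^ k + x - 1 = 0 := by
  have hmono : ∀ x y : ℝ, 0 < x → x < y → x ^ k + x - 1 < y ^ k + y - 1 := by
    intro x y hx hxy
    have := pow_le_pow_left₀ hx.le hxy.le k
    linarith
  have hcont : ContinuousOn (fun x : ℝ => x ^ k + x - 1) (Set.Icc 0 1) := by fun_prop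
  have h0 : (0 : ℝ) ^ k = 0 := zero_pow (by omega)
  have hmem : (0 : ℝ) ∈ Set.Icc ((fun x : ℝ => x ^ k + x - 1) 0)
      ((fun x : ℝ => x ^ k + x - 1) 1) := by
    simp [h0]
  obtain ⟨x, hx, hfx⟩ := intermediate_value_Icc zero_le_one hcont hmem
  have hfx' : x ^ k + x - 1 = 0 := hfx
  have hxpos : 0 < x := by
    rcases hx.1.lt_or_eq with h | h
    · exact h
    · rw [← h, h0] at hfx'
      norm_num at hfx'
  refine ⟨x, ⟨hxpos, hfx'⟩, ?_⟩
  rintro y ⟨hy, hfy⟩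
  rcases lt_trichotomy y x with h | h | h
  · have := hmono y x hy h
    linarith
  · exact h
  · have := hmono x y hxpos h
    linarith

/-- `α_k` is the unique positive zero of `X ^ k + X - 1`, for `k ≥ 1`
(the value for `k = 0` is irrelevant). -/
noncomputable def alpha (k : ℕ) : ℝ :=
  if hk : 1 ≤ k then (existsUnique_pos_zero hk).choose else 0

theorem alpha_spec {k : ℕ} (hk : 1 ≤ k) : 0 < alpha k ∧ alpha k ^ k + alpha k - 1 = 0 := by
  rw [alpha, dif_pos hk]
  exact (existsUnique_pos_zero hk).choose_spec.1

/-- `δ_k(n) = F_k(n) - α_k n`. -/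
noncomputable def delta (k n : ℕ) : ℝ := (F k n : ℝ) - alpha k * (n : ℝ)

/-- `sup_n δ_k(n)`, an extended real number. -/
noncomputable def supDelta (k : ℕ) : EReal := ⨆ n : ℕ, ((delta k n : ℝ) : EReal)

/-- `inf_n δ_k(n)`, an extended real number. -/
noncomputable def infDelta (k : ℕ) : EReal := ⨅ n : ℕ, ((delta k n : ℝ) : EReal)

/-- The discrepancy `Δ_k = sup_n |δ_k(n)|`, an extended real number. -/
noncomputable def discrepancy (k : ℕ) : EReal := ⨆ n : ℕ, ((|delta k n| : ℝ) : EReal)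

end Hofstadter

/-! Write `A i` for `seq k i`. For k = 3 and 4, `F k` shifts the leading term of the numeration: `F
k (A (i+1) + n) = A i + F k n` for small `n` (`F_seq_add`). Hence `delta k (A (i+1) + n)` is
`seqDelta k i + delta k n` (`delta_seq_add`), and the extrema of `delta k` below `A (M+1)` follow
from those below `A M` and below `A (M+1-k)`.

The dominant root `1/alpha k` of X^k - X^(k-1) - 1 cancels in `seqDelta`, which therefore obeys a
recurrence of order k-1. A suitable multiple of its characteristic polynomial has coefficients of
absolute sum below 1, so the tail sums of |`seqDelta`| are controlled by one short window
(`sum_abs_le_of_contraction`). Extrema over an initial segment thus determine those over all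
integers up to a tiny tail (`delta_enclosure`). The finite part runs in scaled integer arithmetic
with directed rounding and is evaluated by the kernel. -/

namespace Hofstadter

/-! ### The numeration and the shift property of `F` -/

/-- The numeration sequence attached to `F k`: it starts with `k` ones and satisfies
`seq k (i + k) = seq k (i + k - 1) + seq k i`. -/
def seq (k n : ℕ) : ℕ :=
  if _h : n < k ∨ k = 0 then 1 else seq k (n - 1) + seq k (n - k)
  termination_by n
  decreasing_by all_goals omega

theorem seq_of_lt {k n : ℕ} (h : n < k) : seq k n = 1 := by
  rw [seq, dif_pos (Or.inl h)]

theorem seq_add {k : ℕ} (hk : 1 ≤ k) (p : ℕ) : seq k (p + k) = seq k (p + k - 1) + seq k p := by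
  rw [seq, dif_neg (by omega), Nat.add_sub_cancel]

theorem seq_succ_add {k : ℕ} (hk : 1 ≤ k) (p : ℕ) :
    seq k (p + k + 1) = seq k (p + k) + seq k (p + 1) := by
  have := seq_add hk (p + 1)
  rwa [show p + 1 + k = p + k + 1 by omega, Nat.add_sub_cancel] at this

theorem seq_pos (k n : ℕ) : 0 < seq k n := by
  induction n using Nat.strong_induction_on with
  | _ n ih =>
    by_cases h : n < k ∨ k = 0
    · rw [seq, dif_pos h]; exact one_pos
    · rw [seq, dif_neg h]
      exact Nat.add_pos_left (ih _ (by omega)) _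

theorem seq_mono {k : ℕ} (hk : 1 ≤ k) : Monotone (seq k) := by
  refine monotone_nat_of_le_succ fun n => ?_
  by_cases h : n + 1 < k
  · rw [seq_of_lt h, seq_of_lt (by omega)]
  · have := seq_add hk (n + 1 - k)
    rw [show n + 1 - k + k = n + 1 by omega, Nat.add_sub_cancel] at this
    omega

theorem lt_seq_add {k : ℕ} (hk : 1 ≤ k) (n : ℕ) : n < seq k (n + k) := by
  induction n with
  | zero => exact seq_pos _ _
  | succ n ih =>
    have := seq_succ_add hk n
    have h1 := seq_pos k (n + 1)
    rw [show n + 1 + k = n + k + 1 by omega]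
    omega

theorem iterate_step_of_step {f : ℕ → ℕ} {n : ℕ} (h0 : ∀ m, f m ≤ m)
    (h : ∀ m < n, f m ≤ f (m + 1) ∧ f (m + 1) ≤ f m + 1) (j m : ℕ) (hm : m < n) :
    f^[j] m ≤ f^[j] (m + 1) ∧ f^[j] (m + 1) ≤ f^[j] m + 1 := by
  have hle : ∀ j, f^[j] m ≤ m := fun j => by
    induction j with
    | zero => exact le_rfl
    | succ j ih => rw [Function.iterate_succ_apply']; exact (h0 _).trans ih
  induction j with
  | zero => simp
  | succ j ih =>
    rw [Function.iterate_succ_apply', Function.iterate_succ_apply']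
    have hj := h _ ((hle j).trans_lt hm)
    rcases (by omega : f^[j] (m + 1) = f^[j] m ∨ f^[j] (m + 1) = f^[j] m + 1) with e | e
    · rw [e]; omega
    · rw [e]; exact hj

theorem F_one (k : ℕ) : F k 1 = 1 := by
  have h : (F k)^[k] 0 = 0 := Nat.le_zero.1 (F_iterate_le k k 0)
  rw [F_succ, h]

/-- By the recursion, an increment of `F k` is 1 minus an earlier increment of its k-th iterate;
steps in {0, 1} pass to iterates. -/
theorem F_step (k n : ℕ) : F k n ≤ F k (n + 1) ∧ F k (n + 1) ≤ F k n + 1 := by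
  induction n using Nat.strong_induction_on with
  | _ n ih =>
    rcases n with _ | n
    · have := F_le k 1
      simp only [F_zero, zero_add]; omega
    · have h := iterate_step_of_step (F_le k) ih k n (Nat.lt_succ_self n)
      have h1 := F_iterate_le k k n
      rw [F_succ k (n + 1), F_succ k n]
      omega

theorem F_mono (k : ℕ) : Monotone (F k) := monotone_nat_of_le_succ fun n => (F_step k n).1

/-- `F k` acts on the leading term of the numeration as a right shift, provided it does so for
the first few terms. -/
theorem F_seq_add {k : ℕ} (hk : 2 ≤ k)
    (base : ∀ p < k - 1, ∀ n ≤ 1, F k (p + 2 + n) = p + 1 + F k n)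
    (p n : ℕ) (hn : n ≤ seq k (p + 1)) :
    F k (seq k (p + k) + n) = seq k (p + k - 1) + F k n := by
  have hsmall : ∀ p ≤ k, seq k (p + k - 1) = p + 1 := by
    intro p
    induction p with
    | zero => intro _; rw [seq_of_lt (by omega)]
    | succ p ih =>
      intro hp
      rw [show p + 1 + k - 1 = p + k by omega, seq_add (by omega), ih (by omega),
        seq_of_lt (show p < k by omega)]
  induction p using Nat.strong_induction_on generalizing n with
  | _ p ih =>
    rcases lt_or_ge p (k - 1) with hp | hp
    · rw [seq_of_lt (show p + 1 < k by omega)] at hn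
      rw [hsmall p (by omega), ← base p hp n hn]
      have := hsmall (p + 1) (by omega)
      rw [show p + 1 + k - 1 = p + k by omega] at this
      rw [this]
    · have hF : ∀ i, i + 1 < p + k → F k (seq k (i + 1)) = seq k i := by
        intro i hi
        rcases lt_or_ge (i + 1) k with h | h
        · rw [seq_of_lt h, seq_of_lt (by omega), F_one k]
        · have := ih (i + 1 - k) (by omega) 0 (Nat.zero_le _)
          rw [show i + 1 - k + k = i + 1 by omega] at this
          simpa [F_zero] using this
      induction n with
      | zero =>
        -- The sum `seq k (p + k - 1) + seq k p` is the extreme case of the previous level; this is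
        -- why the hypothesis on `n` is ≤ rather than <.
        have h := ih (p - 1) (by omega) (seq k p) (by rw [Nat.sub_add_cancel (by omega)])
        rw [show p - 1 + k = p + k - 1 by omega, ← seq_add (by omega)] at h
        have h1 := hF (p - 1) (by omega)
        rw [Nat.sub_add_cancel (by omega)] at h1
        have h2 := seq_add (show 1 ≤ k by omega) (p - 1)
        rw [show p - 1 + k = p + k - 1 by omega] at h2
        rw [F_zero, add_zero, add_zero, h, h1, h2]
      | succ n ihn =>
        have hn' := ihn (by omega)
        -- Each application of `F k` lowers the leading index by one while the remainder stays
        -- admissible for the new index. The first uses the induction on `n`, the others the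
        -- induction on `p`.
        have key : ∀ j ≤ k, (F k)^[j] (seq k (p + k) + n) = seq k (p + k - j) + (F k)^[j] n ∧
            (F k)^[j] n ≤ seq k (p + 1 - j) := by
          intro j
          induction j with
          | zero => intro _; exact ⟨rfl, by
            rw [Function.iterate_zero, id, Nat.sub_zero]; omega⟩
          | succ j ihj =>
            intro hj
            obtain ⟨h1, h2⟩ := ihj (by omega)
            rw [Function.iterate_succ_apply', Function.iterate_succ_apply', h1]
            constructor
            · rcases Nat.eq_zero_or_pos j with rfl | hj0
              · exact hn'
              · have := ih (p - j) (by omega) ((F k)^[j] n)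
                  (by rwa [show p - j + 1 = p + 1 - j by omega])
                rw [show p - j + k = p + k - j by omega] at this
                exact this
            · have h3 := hF (p - j) (by omega)
              have h4 := F_mono k h2
              rw [show p - j + 1 = p + 1 - j by omega] at h3
              rw [h3] at h4
              rwa [show p + 1 - (j + 1) = p - j by omega]
        have h := (key k le_rfl).1
        rw [Nat.add_sub_cancel] at h
        rw [← add_assoc, F_succ, F_succ, h]
        have := F_iterate_le k k n
        have := seq_add (show 1 ≤ k by omega) p
        omega

/-! ### Additivity of delta and control of tails -/

/-- The value `δ_k (seq k (i + 1))`. -/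
noncomputable def seqDelta (k i : ℕ) : ℝ := (seq k i : ℝ) - alpha k * (seq k (i + 1) : ℝ)

theorem delta_zero (k : ℕ) : delta k 0 = 0 := by simp [delta, F_zero]

/-- `δ_k` is additive along the numeration. -/
theorem delta_seq_add {k : ℕ} (hk : 2 ≤ k)
    (base : ∀ p < k - 1, ∀ n ≤ 1, F k (p + 2 + n) = p + 1 + F k n)
    {i n : ℕ} (hi : k ≤ i + 2) (hn : n < seq k (i + 2 - k)) :
    delta k (seq k (i + 1) + n) = seqDelta k i + delta k n := by
  have h : F k (seq k (i + 1) + n) = seq k i + F k n := by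
    rcases Nat.eq_or_lt_of_le hi with h | h
    · rw [← h, Nat.sub_self, seq_of_lt (by omega)] at hn
      obtain rfl : n = 0 := by omega
      rw [seq_of_lt (show i + 1 < k by omega), seq_of_lt (show i < k by omega), F_zero,
        F_one k]
    · have := F_seq_add hk base (i + 1 - k) n (by
        rw [show i + 1 - k + 1 = i + 2 - k by omega]; exact hn.le)
      rwa [show i + 1 - k + k = i + 1 by omega, Nat.add_sub_cancel] at this
  rw [delta, delta, seqDelta, h]
  push_cast
  ring

theorem seqDelta_add {k : ℕ} (hk : 2 ≤ k) (i : ℕ) :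
    seqDelta k (i + k) = seqDelta k (i + k - 1) + seqDelta k i := by
  have h1 := seq_add (show 1 ≤ k by omega) i
  have h2 := seq_succ_add (show 1 ≤ k by omega) i
  rw [seqDelta, seqDelta, seqDelta, h2, h1, show i + k - 1 + 1 = i + k by omega, h1]
  push_cast
  ring

/-- Summable tails from a contracting linear recurrence. -/
theorem sum_abs_le_of_contraction {c w : ℕ → ℝ} {m N : ℕ} {W K : ℝ}
    (hw : ∀ i, 0 ≤ w i) (hW : ∑ i ∈ Finset.range m, w i ≤ W) (hK : 0 ≤ K)
    (hc : ∀ d, |c (d + m)| ≤ ∑ i ∈ Finset.range m, w i * |c (d + i)|)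
    (hwin : ∑ i ∈ Finset.range m, |c (N + i)| ≤ (1 - W) * K) (M : ℕ) :
    ∑ i ∈ Finset.range M, |c (N + i)| ≤ K := by
  have hW0 : 0 ≤ W := (Finset.sum_nonneg fun i _ => hw i).trans hW
  induction M using Nat.strong_induction_on with
  | _ M ih =>
    rcases lt_or_ge M m with h | h
    · calc ∑ i ∈ Finset.range M, |c (N + i)| ≤ ∑ i ∈ Finset.range m, |c (N + i)| :=
            Finset.sum_le_sum_of_subset_of_nonneg (Finset.range_mono h.le)
              fun _ _ _ => abs_nonneg _
        _ ≤ (1 - W) * K := hwin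
        _ ≤ K := by nlinarith
    · obtain ⟨M, rfl⟩ := Nat.exists_eq_add_of_le h
      rw [Finset.sum_range_add]
      -- Beyond the window, each term is dominated by weighted earlier terms. After swapping sums,
      -- each inner sum is part of a shorter partial sum, already at most `K`.
      have h1 : ∑ x ∈ Finset.range M, |c (N + (m + x))| ≤ W * K := calc
        ∑ x ∈ Finset.range M, |c (N + (m + x))|
            ≤ ∑ x ∈ Finset.range M, ∑ i ∈ Finset.range m, w i * |c (N + (x + i))| := by
              refine Finset.sum_le_sum fun x _ => ?_
              have := hc (N + x)
              rw [show N + (m + x) = N + x + m by omega]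
              simpa only [add_assoc] using this
        _ = ∑ i ∈ Finset.range m, w i * ∑ x ∈ Finset.range M, |c (N + (i + x))| := by
              rw [Finset.sum_comm]
              simp only [Finset.mul_sum, add_comm]
        _ ≤ ∑ i ∈ Finset.range m, w i * K := by
              refine Finset.sum_le_sum fun i hi => mul_le_mul_of_nonneg_left ?_ (hw i)
              have hi' := Finset.mem_range.1 hi
              refine le_trans ?_ (ih (i + M) (by omega))
              rw [Finset.sum_range_add]
              exact le_add_of_nonneg_left (Finset.sum_nonneg fun _ _ => abs_nonneg _)
        _ ≤ W * K := by
              rw [← Finset.sum_mul]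
              exact mul_le_mul_of_nonneg_right hW hK
      linarith

/-- A bound below `seq k (N + 1)` extends to all integers at the cost of a tail sum. -/
theorem delta_le_of_tail {k : ℕ} (hk : 2 ≤ k)
    (base : ∀ p < k - 1, ∀ n ≤ 1, F k (p + 2 + n) = p + 1 + F k n)
    {q h K : ℝ} {N : ℕ} (hN : k ≤ N + 2) (hh : ∀ n < seq k (N + 1), q * delta k n ≤ h)
    (hK : ∀ M, ∑ i ∈ Finset.range M, |q * seqDelta k (N + i)| ≤ K) (n : ℕ) :
    q * delta k n ≤ h + K := by
  have key : ∀ j, ∀ n < seq k (N + j + 1),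
      q * delta k n ≤ h + ∑ i ∈ Finset.range j, |q * seqDelta k (N + i)| := by
    intro j
    induction j with
    | zero => simpa using hh
    | succ j ih =>
      intro n hn
      rw [Finset.sum_range_succ]
      have habs := abs_nonneg (q * seqDelta k (N + j))
      rcases lt_or_ge n (seq k (N + j + 1)) with h1 | h1
      · linarith [ih n h1]
      · obtain ⟨r, rfl⟩ := Nat.exists_eq_add_of_le h1
        have h2 : seq k (N + (j + 1) + 1) = seq k (N + j + 1) + seq k (N + j + 2 - k) := by
          have := seq_add (show 1 ≤ k by omega) (N + j + 2 - k)
          rwa [show N + j + 2 - k + k = N + j + 2 by omega] at this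
        have h3 : r < seq k (N + j + 2 - k) := by omega
        have h4 := ih r (h3.trans_le (seq_mono (by omega) (by omega)))
        rw [delta_seq_add hk base (by omega) h3, mul_add]
        linarith [le_abs_self (q * seqDelta k (N + j))]
  have hn : n < seq k (N + (n + k) + 1) :=
    (lt_seq_add (by omega) n).trans_le (seq_mono (by omega) (by omega))
  linarith [key _ n hn, hK (n + k)]

/-! ### Certified integer computation of extrema -/

/-- Applies `f` to `n`, in a form that makes reduction evaluate `n` first. -/
def forceNat {β : Type} (n : ℕ) (f : ℕ → β) : β := Nat.rec (f 0) (fun m _ => f (m + 1)) n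

theorem forceNat_eq {β : Type} (n : ℕ) (f : ℕ → β) : forceNat n f = f n := by
  cases n <;> rfl

/-- Applies `f` to `x`, in a form that makes reduction evaluate `x` first. -/
def forceInt {β : Type} (x : ℤ) (f : ℤ → β) : β :=
  match x with
  | Int.ofNat n => forceNat n fun n => f (Int.ofNat n)
  | Int.negSucc n => forceNat n fun n => f (Int.negSucc n)

theorem forceInt_eq {β : Type} (x : ℤ) (f : ℤ → β) : forceInt x f = f x := by
  cases x
  · exact forceNat_eq _ fun n => f (Int.ofNat n)
  · exact forceNat_eq _ fun n => f (Int.negSucc n)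

/-- One stage of the computation of the extremal values of `q * δ_k`: a term `b` of the
numeration, a lower bound for `q * δ_k b`, and bounds for `q * δ_k` below `b`. -/
structure Stage where
  b : ℤ
  base : ℤ
  lo : ℤ
  hi : ℤ

/-- Appends one stage in front of a list of stages. -/
def nextStage (k : ℕ) (q a : ℤ) (L : List Stage) : List Stage :=
  match L, L.drop (k - 1) with
  | e :: t, e' :: _ =>
    forceInt (e.b + e'.b) fun b =>
    forceInt (q * e.b - (a + 1) * b) fun base =>
    forceInt (max e.lo (e.base + e'.lo)) fun lo =>
    forceInt (max e.hi (e.base + e.b + e'.hi)) fun hi =>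
    ⟨b, base, lo, hi⟩ :: e :: t
  | _, _ => L

/-- The newest stage comes first, so the index of a stage is the length of the list behind it.
Initially all terms are 1 and `seqDelta` is `1 - alpha k`; at index 0 the field `base` carries no
meaning. -/
def stages (k : ℕ) (q a : ℤ) : ℕ → List Stage
  | 0 => List.replicate k ⟨1, q - (a + 1), 0, 0⟩
  | n + 1 => nextStage k q a (stages k q a n)

def headSatisfies (P : Stage → Bool) : List Stage → Bool
  | [] => false
  | e :: _ => P e

/-- The stage at position `m` supplies the extremal bounds; the `m + 1` stages from it to the newest
form the window that controls the tail. -/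
def checkStages (k : ℕ) (q a : ℤ) (steps m : ℕ) (lo hi ε : ℤ) : Bool :=
  let L := stages k q a steps
  decide (k + m < L.length) &&
    headSatisfies (fun e => decide (lo ≤ e.lo) && decide (e.hi ≤ hi)) (L.drop m) &&
    (List.range (m + 1)).all fun i =>
      headSatisfies (fun e => decide (-ε ≤ e.base) && decide (e.base + e.b ≤ ε)) (L.drop i)

/-- The stage `e` is correct at index `M`. -/
structure Stage.Correct (k : ℕ) (q : ℤ) (M : ℕ) (e : Stage) : Prop where
  b_eq : e.b = seq k M
  base_le : ∀ d, M = d + 1 → e.base ≤ q * seqDelta k d ∧ q * seqDelta k d ≤ e.base + e.b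
  le_hi : ∀ n < seq k M, q * delta k n ≤ e.hi
  lo_le : ∃ n < seq k M, e.lo ≤ q * delta k n

def AllCorrect (k : ℕ) (q : ℤ) : List Stage → Prop
  | [] => True
  | e :: t => e.Correct k q t.length ∧ AllCorrect k q t

theorem AllCorrect.drop {k : ℕ} {q : ℤ} {L : List Stage} (h : AllCorrect k q L) (i : ℕ) :
    AllCorrect k q (L.drop i) := by
  induction i generalizing L with
  | zero => exact h
  | succ i ih =>
    cases L with
    | nil => trivial
    | cons e t => exact ih h.2

theorem AllCorrect.head_drop {k : ℕ} {q : ℤ} {L : List Stage} (h : AllCorrect k q L) {i : ℕ}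
    {P : Stage → Bool} (hP : headSatisfies P (L.drop i) = true) :
    i < L.length ∧ ∃ e : Stage, P e = true ∧ e.Correct k q (L.length - 1 - i) := by
  have hd := h.drop i
  have hl := List.length_drop (i := i) (l := L)
  cases hL : L.drop i with
  | nil => rw [hL] at hP; cases hP
  | cons e t =>
    rw [hL] at hP hd hl
    rw [List.length_cons] at hl
    refine ⟨by omega, e, hP, ?_⟩
    rw [show L.length - 1 - i = t.length by omega]
    exact hd.1

theorem allCorrect_replicate {k : ℕ} {q a : ℤ} (ha : a ≤ q * alpha k) (ha' : q * alpha k ≤ a + 1)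
    {j : ℕ}
    (hj : j ≤ k) : AllCorrect k q (List.replicate j ⟨1, q - (a + 1), 0, 0⟩) := by
  induction j with
  | zero => trivial
  | succ j ih =>
    refine ⟨?_, ih (by omega)⟩
    rw [List.length_replicate]
    have hs : seq k j = 1 := seq_of_lt (by omega)
    constructor
    · simp [hs]
    · rintro d rfl
      rw [seqDelta, hs, seq_of_lt (show d < k by omega)]
      push_cast
      constructor <;> linarith
    · intro n hn
      obtain rfl : n = 0 := by omega
      simp [delta_zero]
    · exact ⟨0, by omega, by simp [delta_zero]⟩

/-- An integer below the new term is either below the old one or the old one plus a remainder below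
the term of index `M + 1 - k`. As `q * alpha k` lies in `[a, a + 1]`, rounding costs at most `b`. -/
theorem correct_next {k : ℕ} {q a : ℤ} (hk : 2 ≤ k)
    (base : ∀ p < k - 1, ∀ n ≤ 1, F k (p + 2 + n) = p + 1 + F k n)
    (ha : a ≤ q * alpha k) (ha' : q * alpha k ≤ a + 1)
    {M : ℕ} (hM : k ≤ M + 1) {e e' : Stage} (he : e.Correct k q M)
    (he' : e'.Correct k q (M + 1 - k)) :
    Stage.Correct k q (M + 1) ⟨e.b + e'.b, q * e.b - (a + 1) * (e.b + e'.b),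
      max e.lo (e.base + e'.lo), max e.hi (e.base + e.b + e'.hi)⟩ := by
  have hs := seq_add (show 1 ≤ k by omega) (M + 1 - k)
  rw [Nat.sub_add_cancel hM, Nat.add_sub_cancel] at hs
  obtain ⟨i, rfl⟩ := Nat.exists_eq_add_of_le' (show 1 ≤ M by omega)
  have hadd : ∀ n < seq k (i + 1 + 1 - k), (q : ℝ) * delta k (seq k (i + 1) + n) =
      q * seqDelta k i + q * delta k n := fun n hn => by
    rw [delta_seq_add hk base (by omega) hn, mul_add]
  obtain ⟨hc, hc'⟩ := he.base_le i rfl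
  constructor
  · simp only [he.b_eq, he'.b_eq, hs]; push_cast; ring
  · rintro d hd
    obtain rfl : d = i + 1 := by omega
    have hp : (0 : ℝ) < seq k (i + 1 + 1) := by exact_mod_cast seq_pos _ _
    have h1 := mul_le_mul_of_nonneg_right ha hp.le
    have h2 := mul_le_mul_of_nonneg_right ha' hp.le
    have hb : (e.b : ℝ) = seq k (i + 1) := by exact_mod_cast he.b_eq
    have hb' : (e.b : ℝ) + e'.b = seq k (i + 1 + 1) := by
      rw [he.b_eq, he'.b_eq, hs]; push_cast; ring
    rw [seqDelta]
    push_cast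
    rw [hb', hb]
    constructor <;> linarith
  · intro n hn
    rw [Int.cast_max, le_max_iff]
    rcases lt_or_ge n (seq k (i + 1)) with h | h
    · exact Or.inl (he.le_hi n h)
    · obtain ⟨r, rfl⟩ := Nat.exists_eq_add_of_le h
      have hr : r < seq k (i + 1 + 1 - k) := by omega
      right
      rw [hadd r hr]
      push_cast
      exact add_le_add hc' (he'.le_hi r hr)
  · dsimp only
    rw [Int.cast_max]
    rcases max_choice ((e.lo : ℤ) : ℝ) ((e.base + e'.lo : ℤ) : ℝ) with h | h <;> rw [h]
    · obtain ⟨n, hn, hle⟩ := he.lo_le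
      exact ⟨n, by omega, hle⟩
    · obtain ⟨n, hn, hle⟩ := he'.lo_le
      refine ⟨seq k (i + 1) + n, by omega, ?_⟩
      rw [hadd n hn]
      push_cast
      exact add_le_add hc hle

theorem allCorrect_stages {k : ℕ} {q a : ℤ} (hk : 2 ≤ k)
    (base : ∀ p < k - 1, ∀ n ≤ 1, F k (p + 2 + n) = p + 1 + F k n)
    (ha : a ≤ q * alpha k) (ha' : q * alpha k ≤ a + 1)
    (n : ℕ) :
    AllCorrect k q (stages k q a n) ∧ k ≤ (stages k q a n).length := by
  induction n with
  | zero => exact ⟨allCorrect_replicate ha ha' le_rfl, by simp [stages]⟩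
  | succ n ih =>
    rw [stages]
    generalize stages k q a n = L at ih
    obtain ⟨hL, hlen⟩ := ih
    unfold nextStage
    split
    · next e t e' t' hdrop =>
      simp only [forceInt_eq]
      have hl := List.length_drop (i := k - 1) (l := e :: t)
      have h' := hL.drop (k - 1)
      rw [hdrop] at hl h'
      simp only [List.length_cons] at hl hlen
      refine ⟨⟨correct_next hk base ha ha' hlen hL.1 ?_, hL⟩, by
        simp only [List.length_cons]; omega⟩
      rw [show t.length + 1 - k = t'.length by omega]
      exact h'.1
    · exact ⟨hL, hlen⟩

/-- The extremal values of `q * δ_k`, certified by a finite computation and a contracting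
linear recurrence for the remaining contributions. -/
theorem delta_enclosure {k : ℕ} {q a : ℤ} (hk : 2 ≤ k)
    (base : ∀ p < k - 1, ∀ n ≤ 1, F k (p + 2 + n) = p + 1 + F k n)
    (ha : a ≤ q * alpha k) (ha' : q * alpha k ≤ a + 1)
    {steps m : ℕ} {lo hi ε : ℤ} {w : ℕ → ℝ} {W K : ℝ}
    (hcheck : checkStages k q a steps m lo hi ε = true)
    (hw : ∀ i, 0 ≤ w i) (hW : ∑ i ∈ Finset.range (m + 1), w i ≤ W) (hK : 0 ≤ K)
    (hc : ∀ d, |seqDelta k (d + (m + 1))| ≤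
      ∑ i ∈ Finset.range (m + 1), w i * |seqDelta k (d + i)|)
    (hε : (m + 1) * (ε : ℝ) ≤ (1 - W) * K) :
    (∀ n, q * delta k n ≤ hi + K) ∧ ∃ n, lo ≤ q * delta k n := by
  obtain ⟨hL, -⟩ := allCorrect_stages hk base ha ha' steps
  unfold checkStages at hcheck
  generalize stages k q a steps = L at hL hcheck
  simp only [Bool.and_eq_true, List.all_eq_true, List.mem_range, decide_eq_true_eq] at hcheck
  obtain ⟨⟨hlen, hm⟩, hwin⟩ := hcheck
  obtain ⟨-, e, he, hcorr⟩ := hL.head_drop hm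
  simp only [Bool.and_eq_true, decide_eq_true_eq] at he
  obtain ⟨N, hN⟩ := Nat.exists_eq_add_of_le' (show 1 ≤ L.length - 1 - m by omega)
  rw [hN] at hcorr
  have hwin' : ∀ i ∈ Finset.range (m + 1), |q * seqDelta k (N + i)| ≤ ε := by
    intro i hi
    rw [Finset.mem_range] at hi
    -- Position `m - i`, since the list runs backwards.
    obtain ⟨-, e, he, hcorr⟩ := hL.head_drop (hwin (m - i) (by omega))
    simp only [Bool.and_eq_true, decide_eq_true_eq] at he
    obtain ⟨h1, h2⟩ := hcorr.base_le (N + i) (by omega)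
    have h3 : -(ε : ℝ) ≤ e.base := by exact_mod_cast he.1
    have h4 : (e.base : ℝ) + e.b ≤ ε := by exact_mod_cast he.2
    exact abs_le.2 ⟨h3.trans h1, h2.trans h4⟩
  have htail := sum_abs_le_of_contraction (c := fun i => q * seqDelta k i) (N := N) hw hW hK
    (fun d => by
      simp only [abs_mul]
      refine (mul_le_mul_of_nonneg_left (hc d) (abs_nonneg _)).trans_eq ?_
      rw [Finset.mul_sum]
      exact Finset.sum_congr rfl fun i _ => by ring)
    ((Finset.sum_le_card_nsmul _ _ _ hwin').trans (by simpa using hε))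
  refine ⟨fun n => ?_, ?_⟩
  · have h1 := delta_le_of_tail hk base (by omega) hcorr.le_hi htail n
    have h2 : (e.hi : ℝ) ≤ hi := by exact_mod_cast he.2
    linarith
  · obtain ⟨n, -, hn⟩ := hcorr.lo_le
    have h2 : (lo : ℝ) ≤ e.lo := by exact_mod_cast he.1
    exact ⟨n, h2.trans hn⟩

/-! ### Contracting recurrences for k = 3 and k = 4 -/

theorem le_alpha {k : ℕ} (hk : 1 ≤ k) {x : ℝ} (h : x ^ k + x - 1 ≤ 0) : x ≤ alpha k := by
  obtain ⟨hpos, heq⟩ := alpha_spec hk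
  by_contra! hlt
  have := pow_le_pow_left₀ hpos.le hlt.le k
  linarith

theorem alpha_le {k : ℕ} (hk : 1 ≤ k) {x : ℝ} (hx : 0 ≤ x) (h : 0 ≤ x ^ k + x - 1) :
    alpha k ≤ x := by
  obtain ⟨-, heq⟩ := alpha_spec hk
  by_contra! hlt
  have := pow_le_pow_left₀ hx hlt.le k
  linarith

theorem F_small_three : ∀ p < 3 - 1, ∀ n ≤ 1, F 3 (p + 2 + n) = p + 1 + F 3 n := by
  have h1 := F_one 3
  have h2 : F 3 2 = 1 := by simp [F_succ 3 1, h1]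
  have h3 : F 3 3 = 2 := by simp [F_succ 3 2, h1, h2]
  have h4 : F 3 4 = 3 := by simp [F_succ 3 3, h1, h2, h3]
  intro p hp n hn
  interval_cases p <;> interval_cases n <;> simp [F_zero, h1, h2, h3, h4]

theorem F_small_four : ∀ p < 4 - 1, ∀ n ≤ 1, F 4 (p + 2 + n) = p + 1 + F 4 n := by
  have h1 := F_one 4
  have h2 : F 4 2 = 1 := by simp [F_succ 4 1, h1]
  have h3 : F 4 3 = 2 := by simp [F_succ 4 2, h1, h2]
  have h4 : F 4 4 = 3 := by simp [F_succ 4 3, h1, h2, h3]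
  have h5 : F 4 5 = 4 := by simp [F_succ 4 4, h1, h2, h3, h4]
  intro p hp n hn
  interval_cases p <;> interval_cases n <;> simp [F_zero, h1, h2, h3, h4, h5]

/-- X^3 - X^2 - 1 has the factor X - 1/α; the cofactor X^2 + α^2 X + α is the characteristic
polynomial here. -/
theorem seqDelta_three_add_two (d : ℕ) :
    seqDelta 3 (d + 2) = -alpha 3 ^ 2 * seqDelta 3 (d + 1) - alpha 3 * seqDelta 3 d := by
  have h : (seq 3 (d + 3) : ℝ) = seq 3 (d + 2) + seq 3 d := by
    exact_mod_cast seq_add (by norm_num) d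
  have ha := (alpha_spec (k := 3) (by norm_num)).2
  simp only [seqDelta, add_assoc, Nat.reduceAdd]
  rw [h]
  linear_combination (-seq 3 (d + 2) : ℝ) * ha

theorem seqDelta_four_add_three (d : ℕ) :
    seqDelta 4 (d + 3) = -alpha 4 ^ 3 * seqDelta 4 (d + 2) - alpha 4 ^ 2 * seqDelta 4 (d + 1)
      - alpha 4 * seqDelta 4 d := by
  have h : (seq 4 (d + 4) : ℝ) = seq 4 (d + 3) + seq 4 d := by
    exact_mod_cast seq_add (by norm_num) d
  have ha := (alpha_spec (k := 4) (by norm_num)).2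
  simp only [seqDelta, add_assoc, Nat.reduceAdd]
  rw [h]
  linear_combination (-seq 4 (d + 3) : ℝ) * ha

/-- The order-2 recurrence has coefficients of absolute sum α^2 + α > 1; one more step brings it
below 0.79. -/
theorem seqDelta_three_add_three (d : ℕ) :
    seqDelta 3 (d + 3) = (1 - alpha 3) * seqDelta 3 d + -alpha 3 ^ 2 * seqDelta 3 (d + 1) := by
  have h1 := seqDelta_add (k := 3) (by norm_num) d
  have h2 := seqDelta_three_add_two d
  simp only [Nat.add_succ_sub_one] at h1
  rw [h1, h2]
  ring

/-- The full recurrence gives s(d+7) = s(d) + s(d+1) + s(d+2) + 2 s(d+3) for s = `seqDelta 4`.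
Eliminating s(d+3) leaves three coefficients of absolute sum below 0.745. -/
theorem seqDelta_four_add_seven (d : ℕ) :
    seqDelta 4 (d + 7) = (1 - 2 * alpha 4) * seqDelta 4 d +
      (1 - 2 * alpha 4 ^ 2) * seqDelta 4 (d + 1) + (1 - 2 * alpha 4 ^ 3) * seqDelta 4 (d + 2) := by
  have h := seqDelta_add (k := 4) (by norm_num)
  have h0 := h d
  have h1 := h (d + 1)
  have h2 := h (d + 2)
  have h3 := h (d + 3)
  have h4 := seqDelta_four_add_three d
  simp only [add_assoc, Nat.reduceAdd, Nat.add_succ_sub_one] at h0 h1 h2 h3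
  rw [h3, h2, h1, h0, h4]
  ring

theorem alpha_three_bounds : 0.682 ≤ alpha 3 ∧ alpha 3 ≤ 0.683 :=
  ⟨le_alpha (by norm_num) (by norm_num), alpha_le (by norm_num) (by norm_num) (by norm_num)⟩

theorem alpha_four_bounds : 0.724 ≤ alpha 4 ∧ alpha 4 ≤ 0.725 :=
  ⟨le_alpha (by norm_num) (by norm_num), alpha_le (by norm_num) (by norm_num) (by norm_num)⟩

theorem abs_seqDelta_three_le (d : ℕ) : |seqDelta 3 (d + (2 + 1))| ≤
    ∑ i ∈ Finset.range (2 + 1), ([0.32, 0.47] : List ℝ).getD i 0 * |seqDelta 3 (d + i)| := by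
  obtain ⟨h1, h2⟩ := alpha_three_bounds
  have e0 : |1 - alpha 3| ≤ 0.32 := abs_le.2 (by constructor <;> linarith)
  have e1 : |-alpha 3 ^ 2| ≤ 0.47 := abs_le.2 (by constructor <;> nlinarith)
  rw [seqDelta_three_add_three]
  simp only [Finset.sum_range_succ, Finset.sum_range_zero, List.getD_cons_zero,
    List.getD_cons_succ, List.getD_nil, zero_mul, zero_add, add_zero]
  refine (abs_add_le _ _).trans ?_
  rw [abs_mul, abs_mul]
  gcongr

theorem abs_seqDelta_four_le (d : ℕ) : |seqDelta 4 (d + (6 + 1))| ≤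
    ∑ i ∈ Finset.range (6 + 1),
      ([0.45, 0.052, 0.242] : List ℝ).getD i 0 * |seqDelta 4 (d + i)| := by
  obtain ⟨h1, h2⟩ := alpha_four_bounds
  have q1 := pow_le_pow_left₀ (by norm_num) h1 2
  have q2 := pow_le_pow_left₀ (by linarith) h2 2
  have c1 := pow_le_pow_left₀ (by norm_num) h1 3
  have c2 := pow_le_pow_left₀ (by linarith) h2 3
  have e0 : |1 - 2 * alpha 4| ≤ 0.45 := abs_le.2 (by constructor <;> linarith)
  have e1 : |1 - 2 * alpha 4 ^ 2| ≤ 0.052 := by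
    norm_num at q1 q2
    exact abs_le.2 (by constructor <;> linarith)
  have e2 : |1 - 2 * alpha 4 ^ 3| ≤ 0.242 := by
    norm_num at c1 c2
    exact abs_le.2 (by constructor <;> linarith)
  rw [seqDelta_four_add_seven]
  simp only [Finset.sum_range_succ, Finset.sum_range_zero, List.getD_cons_zero,
    List.getD_cons_succ, List.getD_nil, zero_mul, zero_add, add_zero]
  refine (abs_add_three _ _ _).trans ?_
  rw [abs_mul, abs_mul, abs_mul]
  gcongr

theorem getD_nonneg {l : List ℝ} (h : ∀ x ∈ l, 0 ≤ x) (i : ℕ) : 0 ≤ l.getD i 0 := by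
  induction l generalizing i with
  | nil => simp
  | cons x l ih =>
    cases i with
    | zero => simpa using h x (by simp)
    | succ i => simpa using ih (fun y hy => h y (by simp [hy])) i

/-- The tail factor 15 suffices because 3 ≤ (1 - 0.79) · 15. -/
theorem delta_three_enclosure {q a lo hi ε : ℤ} (ha : a ≤ q * alpha 3) (ha' : q * alpha 3 ≤ a + 1)
    (hε : 0 ≤ ε) (hcheck : checkStages 3 q a 445 2 lo hi ε = true) :
    (∀ n, q * delta 3 n ≤ hi + 15 * ε) ∧ ∃ n, lo ≤ q * delta 3 n := by
  have hε' : (0 : ℝ) ≤ ε := by exact_mod_cast hε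
  exact delta_enclosure (W := 0.79) (by norm_num) F_small_three ha ha' hcheck
    (getD_nonneg (by norm_num)) (by norm_num [Finset.sum_range_succ]) (by positivity)
    abs_seqDelta_three_le (by push_cast; linarith)

/-- The tail factor 28 suffices because 7 ≤ (1 - 0.745) · 28. -/
theorem delta_four_enclosure {q a lo hi ε : ℤ} (ha : a ≤ q * alpha 4) (ha' : q * alpha 4 ≤ a + 1)
    (hε : 0 ≤ ε) (hcheck : checkStages 4 q a 680 6 lo hi ε = true) :
    (∀ n, q * delta 4 n ≤ hi + 28 * ε) ∧ ∃ n, lo ≤ q * delta 4 n := by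
  have hε' : (0 : ℝ) ≤ ε := by exact_mod_cast hε
  exact delta_enclosure (W := 0.745) (by norm_num) F_small_four ha ha' hcheck
    (getD_nonneg (by norm_num)) (by norm_num [Finset.sum_range_succ]) (by positivity)
    abs_seqDelta_four_le (by push_cast; linarith)

/-! ### Numerical enclosures -/

theorem alpha_three_approx :
    (68232780382801932736948373971104825689118858189799857780372860663989667868699802108173204378620512829559331876 : ℝ) ≤ 10 ^ 110 * alpha 3 ∧
      10 ^ 110 * alpha 3 ≤ (68232780382801932736948373971104825689118858189799857780372860663989667868699802108173204378620512829559331876 : ℝ) + 1 := by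
  have h1 : (68232780382801932736948373971104825689118858189799857780372860663989667868699802108173204378620512829559331876 : ℝ) / 10 ^ 110 ≤ alpha 3 :=
    le_alpha (by norm_num) (by norm_num)
  have h2 : alpha 3 ≤ ((68232780382801932736948373971104825689118858189799857780372860663989667868699802108173204378620512829559331876 : ℝ) + 1) / 10 ^ 110 :=
    alpha_le (by norm_num) (by norm_num) (by norm_num)
  rw [div_le_iff₀' (by positivity)] at h1
  rw [le_div_iff₀' (by positivity)] at h2
  exact ⟨h1, h2⟩

theorem alpha_four_approx :
    (724491959000515611588372282187036565786494481350011017270398028437452906475124367917583281145440019314884606973811331213 : ℝ) ≤ 10 ^ 120 * alpha 4 ∧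
      10 ^ 120 * alpha 4 ≤ (724491959000515611588372282187036565786494481350011017270398028437452906475124367917583281145440019314884606973811331213 : ℝ) + 1 := by
  have h1 : (724491959000515611588372282187036565786494481350011017270398028437452906475124367917583281145440019314884606973811331213 : ℝ) / 10 ^ 120 ≤ alpha 4 :=
    le_alpha (by norm_num) (by norm_num)
  have h2 : alpha 4 ≤ ((724491959000515611588372282187036565786494481350011017270398028437452906475124367917583281145440019314884606973811331213 : ℝ) + 1) / 10 ^ 120 :=
    alpha_le (by norm_num) (by norm_num) (by norm_num)
  rw [div_le_iff₀' (by positivity)] at h1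
  rw [le_div_iff₀' (by positivity)] at h2
  exact ⟨h1, h2⟩

theorem delta_three_upper : (∀ n, delta 3 n ≤ 0.854187179928304211983581540152668) ∧
    ∃ n, 0.854187179928304211983581540152665 ≤ delta 3 n := by
  obtain ⟨h1, h2⟩ := alpha_three_approx
  -- The scale leaves room for the rounding error `b` under `ε`. The tail allowance `15 * ε`, worth
  -- 1.5·10^(-34) unscaled, is deducted from `hi` in advance.
  obtain ⟨hu, n, hn⟩ := delta_three_enclosure (q := 10 ^ 110)
    (a := 68232780382801932736948373971104825689118858189799857780372860663989667868699802108173204378620512829559331876)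
    (lo := 854187179928304211983581540152665 * 10 ^ 77)
    (hi := 854187179928304211983581540152668 * 10 ^ 77 - 15 * 10 ^ 75) (ε := 10 ^ 75)
    (by push_cast; linarith) (by push_cast; linarith) (by norm_num) (by decide +kernel)
  push_cast at hu hn
  exact ⟨fun n => by linarith [hu n], n, by linarith⟩

theorem delta_three_lower : (∀ n, -0.708415898743967960305146324178773 ≤ delta 3 n) ∧
    ∃ n, delta 3 n ≤ -0.708415898743967960305146324178770 := by
  obtain ⟨h1, h2⟩ := alpha_three_approx
  -- A negative scale turns the infimum into a supremum; the lower bound for `q * alpha 3` is then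
  -- minus the former upper bound.
  obtain ⟨hu, n, hn⟩ := delta_three_enclosure (q := -(10 ^ 110))
    (a := -(68232780382801932736948373971104825689118858189799857780372860663989667868699802108173204378620512829559331876 + 1))
    (lo := 708415898743967960305146324178770 * 10 ^ 77)
    (hi := 708415898743967960305146324178773 * 10 ^ 77 - 15 * 10 ^ 75) (ε := 10 ^ 75)
    (by push_cast; linarith) (by push_cast; linarith) (by norm_num) (by decide +kernel)
  push_cast at hu hn
  exact ⟨fun n => by linarith [hu n], n, by linarith⟩

theorem delta_four_upper : (∀ n, delta 4 n ≤ 1.5834687793247475) ∧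
    ∃ n, 1.5834687793247469 ≤ delta 4 n := by
  obtain ⟨h1, h2⟩ := alpha_four_approx
  -- The deducted tail `28 * ε` is worth 2.8·10^(-17) unscaled.
  obtain ⟨hu, n, hn⟩ := delta_four_enclosure (q := 10 ^ 120)
    (a := 724491959000515611588372282187036565786494481350011017270398028437452906475124367917583281145440019314884606973811331213)
    (lo := 15834687793247469 * 10 ^ 104)
    (hi := 15834687793247475 * 10 ^ 104 - 28 * 10 ^ 102) (ε := 10 ^ 102)
    (by push_cast; linarith) (by push_cast; linarith) (by norm_num) (by decide +kernel)
  push_cast at hu hn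
  exact ⟨fun n => by linarith [hu n], n, by linarith⟩

theorem delta_four_lower : (∀ n, -1.5060895457389591 ≤ delta 4 n) ∧
    ∃ n, delta 4 n ≤ -1.5060895457389585 := by
  obtain ⟨h1, h2⟩ := alpha_four_approx
  obtain ⟨hu, n, hn⟩ := delta_four_enclosure (q := -(10 ^ 120))
    (a := -(724491959000515611588372282187036565786494481350011017270398028437452906475124367917583281145440019314884606973811331213 + 1))
    (lo := 15060895457389585 * 10 ^ 104)
    (hi := 15060895457389591 * 10 ^ 104 - 28 * 10 ^ 102) (ε := 10 ^ 102)
    (by push_cast; linarith) (by push_cast; linarith) (by norm_num) (by decide +kernel)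
  push_cast at hu hn
  exact ⟨fun n => by linarith [hu n], n, by linarith⟩

theorem supDelta_enclosure {k : ℕ} {l u : ℝ} (h : (∀ n, delta k n ≤ u) ∧ ∃ n, l ≤ delta k n) :
    (l : EReal) ≤ supDelta k ∧ supDelta k ≤ u := by
  obtain ⟨hu, n, hn⟩ := h
  exact ⟨(EReal.coe_le_coe_iff.2 hn).trans (le_iSup (fun n => ((delta k n : ℝ) : EReal)) n),
    iSup_le fun n => EReal.coe_le_coe_iff.2 (hu n)⟩

theorem infDelta_enclosure {k : ℕ} {l u : ℝ} (h : (∀ n, l ≤ delta k n) ∧ ∃ n, delta k n ≤ u) :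
    (l : EReal) ≤ infDelta k ∧ infDelta k ≤ u := by
  obtain ⟨hl, n, hn⟩ := h
  exact ⟨le_iInf fun n => EReal.coe_le_coe_iff.2 (hl n),
    (iInf_le (fun n => ((delta k n : ℝ) : EReal)) n).trans (EReal.coe_le_coe_iff.2 hn)⟩

/-- One value at least `l` outweighs the absolute value of every negative one. -/
theorem discrepancy_eq_supDelta {k : ℕ} {l : ℝ} (h : ∃ n, l ≤ delta k n)
    (h' : ∀ n, -l ≤ delta k n) : discrepancy k = supDelta k := by
  refine le_antisymm (iSup_le fun n => ?_) (iSup_mono fun n =>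
    EReal.coe_le_coe_iff.2 (le_abs_self _))
  have hle : ∀ n, ((delta k n : ℝ) : EReal) ≤ supDelta k :=
    le_iSup fun n => ((delta k n : ℝ) : EReal)
  obtain ⟨m, hm⟩ := h
  rcases abs_choice (delta k n) with e | e <;> rw [e]
  · exact hle n
  · exact (EReal.coe_le_coe_iff.2 (by linarith [h' n])).trans (hle m)

end Hofstadter

theorem theoremt :
    -- enclosures for `k = 3`
    ((((0.854187179928304211983581540152668 - 3 * (10 : ℝ) ^ (-33 : ℤ) : ℝ) : EReal)
          ≤ Hofstadter.supDelta 3 ∧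
        Hofstadter.supDelta 3 ≤ ((0.854187179928304211983581540152668 : ℝ) : EReal)) ∧
      (((-0.708415898743967960305146324178773 : ℝ) : EReal) ≤ Hofstadter.infDelta 3 ∧
        Hofstadter.infDelta 3
          ≤ ((-0.708415898743967960305146324178773 + 3 * (10 : ℝ) ^ (-33 : ℤ) : ℝ) : EReal))) ∧
    -- enclosures for `k = 4`
    ((((1.5834687793247475 - 6 * (10 : ℝ) ^ (-16 : ℤ) : ℝ) : EReal) ≤ Hofstadter.supDelta 4 ∧
        Hofstadter.supDelta 4 ≤ ((1.5834687793247475 : ℝ) : EReal)) ∧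
      (((-1.5060895457389591 : ℝ) : EReal) ≤ Hofstadter.infDelta 4 ∧
        Hofstadter.infDelta 4
          ≤ ((-1.5060895457389591 + 6 * (10 : ℝ) ^ (-16 : ℤ) : ℝ) : EReal))) ∧
    -- the discrepancy for `k = 3`
    (Hofstadter.discrepancy 3 = Hofstadter.supDelta 3 ∧
      ((0.854187179928304211983581540152668 - 3 * (10 : ℝ) ^ (-33 : ℤ) : ℝ) : EReal)
        ≤ Hofstadter.discrepancy 3 ∧
      Hofstadter.discrepancy 3 ≤ ((0.854187179928304211983581540152668 : ℝ) : EReal) ∧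
      Hofstadter.discrepancy 3 < 1) ∧
    -- the discrepancy for `k = 4`
    (Hofstadter.discrepancy 4 = Hofstadter.supDelta 4 ∧
      ((1.5834687793247475 - 6 * (10 : ℝ) ^ (-16 : ℤ) : ℝ) : EReal)
        ≤ Hofstadter.discrepancy 4 ∧
      Hofstadter.discrepancy 4 ≤ ((1.5834687793247475 : ℝ) : EReal) ∧
      Hofstadter.discrepancy 4 < 2) := by
  have e3 : (0.854187179928304211983581540152668 - 3 * (10 : ℝ) ^ (-33 : ℤ) : ℝ) =
      0.854187179928304211983581540152665 := by norm_num
  have e3' : (-0.708415898743967960305146324178773 + 3 * (10 : ℝ) ^ (-33 : ℤ) : ℝ) =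
      -0.708415898743967960305146324178770 := by norm_num
  have e4 : (1.5834687793247475 - 6 * (10 : ℝ) ^ (-16 : ℤ) : ℝ) = 1.5834687793247469 := by norm_num
  have e4' : (-1.5060895457389591 + 6 * (10 : ℝ) ^ (-16 : ℤ) : ℝ) = -1.5060895457389585 := by
    norm_num
  rw [e3, e3', e4, e4']
  have s3 := Hofstadter.supDelta_enclosure Hofstadter.delta_three_upper
  have s4 := Hofstadter.supDelta_enclosure Hofstadter.delta_four_upper
  have d3 := Hofstadter.discrepancy_eq_supDelta Hofstadter.delta_three_upper.2
    fun n => (Hofstadter.delta_three_lower.1 n).trans' (by norm_num)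
  have d4 := Hofstadter.discrepancy_eq_supDelta Hofstadter.delta_four_upper.2
    fun n => (Hofstadter.delta_four_lower.1 n).trans' (by norm_num)
  refine ⟨⟨s3, Hofstadter.infDelta_enclosure Hofstadter.delta_three_lower⟩,
    ⟨s4, Hofstadter.infDelta_enclosure Hofstadter.delta_four_lower⟩,
    ⟨d3, ?_⟩, ⟨d4, ?_⟩⟩
  · rw [d3]
    exact ⟨s3.1, s3.2, s3.2.trans_lt (EReal.coe_lt_coe_iff.2 (by norm_num))⟩
  · rw [d4]
    exact ⟨s4.1, s4.2, s4.2.trans_lt (EReal.coe_lt_coe_iff.2 (by norm_num))⟩
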